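/- Let $G=(V,E,W_E)$ be a finite connected (simple, undirected) graph with positive edge weights. A \emph{path choice function} $g$ on $G$ assigns to all $v,w\in V$ a path $g(v,w)$ in $G$ from $v$ to $w$, such that $g(w,v)$ is $g(v,w)$ reversed and every subpath of $g(v,w)$ from $x$ to $y$ is equal to $g(x,y)$. Its \emph{path-representable distance} is $d_g(v,w)=\sum_{e\in g(v,w)}W_E(e)$, and $g$ is \emph{cost-dominated} if $d_g(v,w)\le W_E(e)$ for every edge $e=(v,w)\in E$. Let $\mathbb{X}$ be the set of nonempty subsets of $V$ (the full simplicial complex), and for a distance $d$ on $V$ let $f_d(\sigma)=\max_{v,w\in\sigma}d(v,w)$ for $\sigma\in\mathbb{X}$. A \emph{simplex ordering} $\pi$ is a total order on $\mathbb{X}$ in which every proper face of a simplex precedes it. Given $d$ and $\pi$, list the simplices $\sigma_1,\sigma_2,\dots,\sigma_N$ by increasing $f_d$, ties being broken by $\pi$; let $\mathbf{D}$ be the boundary matrix over $\mathbb{Z}/2$ in this order and $\mathbf{R}=\mathbf{D}\mathbf{V}$ its reduction by the standard left-to-right column algorithm, and let $\mathrm{low}_{\mathbf{R}}(j)$ be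 the largest row index of a nonzero entry in column $j$ of $\mathbf{R}$. The bars of $\mathbf{bcd}_1(d)$ are given by the pairs $(\sigma_i,\sigma_j)$ with $\dim\sigma_i=1$, $\mathrm{low}_{\mathbf{R}}(j)=i$ and $f_d(\sigma_i)<f_d(\sigma_j)$; the bar has birth time $f_d(\sigma_i)$ and death time $f_d(\sigma_j)$, and $\sigma_i$ is called a \emph{birth edge} of $\mathbf{bcd}_1(d)$. Let $d_1,d_2$ be the path-representable distances of two cost-dominated path choice functions $g_1,g_2$ on $G$, let $f_1=f_{d_1}$, $f_2=f_{d_2}$, and suppose that $d_2(v,w)\le d_1(v,w)$ for all $v,w\in V$. Then there is a simplex ordering $\pi$, used for both $d_1$ and $d_2$, such that every birth edge of $\mathbf{bcd}_1(d_2)$ is a birth edge of $\mathbf{bcd}_1(d_1)$, i.e. $\mathcal{B}_2\subseteq\mathcal{B}_1$; moreover, whenever a birth edge $\sigma$ is paired with $\tau_2$ in $\mathbf{bcd}_1(d_2)$ and with $\tau_1$ in $\mathbf{bcd}_1(d_1)$, the death times satisfy $f_2(\tau_2)\le f_1(\tau_1)$. -/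

import Mathlib

/-! ### Path choice functions and path-representable distances -/

/-- A path choice function on a graph `G`: it chooses, for any two vertices `v, w`, a path from `v`
to `w`, in a symmetric way (the path chosen from `w` to `v` is the same path traversed backwards)
and consistently (every subpath of a chosen path is itself the chosen path between its
endpoints). -/
structure PathChoice {V : Type*} (G : SimpleGraph V) where
  path : ∀ v w : V, G.Walk v w
  isPath : ∀ v w : V, (path v w).IsPath
  symm : ∀ v w : V, path w v = (path v w).reverse
  consistent : ∀ (v w x y : V) (q : G.Walk x y), q.IsSubwalk (path v w) → path x y = q

/-- The path-representable distance of `g`: the sum of the weights of the edges of the chosen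
path. -/
def PathChoice.dist {V : Type*} {G : SimpleGraph V} (g : PathChoice G) (W : Sym2 V → ℝ)
    (v w : V) : ℝ :=
  ((g.path v w).edges.map W).sum

/-- `g` is cost-dominated if the path chosen between the endpoints of an edge of `G` costs at most
the weight of that edge. -/
def PathChoice.CostDominated {V : Type*} {G : SimpleGraph V} (g : PathChoice G)
    (W : Sym2 V → ℝ) : Prop :=
  ∀ v w : V, G.Adj v w → g.dist W v w ≤ W s(v, w)

/-! ### The Rips filtration of a finite set with a distance -/

/-- The simplices of the full simplicial complex on `V`: the nonempty subsets of `V`. -/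
abbrev Simplex (V : Type*) : Type _ := {s : Finset V // s.Nonempty}

/-- The filtration function induced by `d`: the largest distance between two vertices of the
simplex. -/
noncomputable def ripsValue {V : Type*} (d : V → V → ℝ) (σ : Simplex V) : ℝ :=
  (σ.1 ×ˢ σ.1).sup' (σ.2.product σ.2) (fun p => d p.1 p.2)

/-- A simplex ordering: an enumeration of all simplices in which every proper face of a simplex
comes before that simplex. -/
structure SimplexOrdering (V : Type*) [Fintype V] [DecidableEq V] where
  enum : Fin (Fintype.card (Simplex V)) ≃ Simplex V
  face_lt : ∀ σ τ : Simplex V, σ.1 ⊂ τ.1 → enum.symm σ < enum.symm τ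

/-- The enumeration `σ₁, σ₂, …` of the simplices by increasing value of `f`, where ties are broken
by the simplex ordering `π` (`Tuple.sort` is the stable sort). -/
noncomputable def SimplexOrdering.sorted {V : Type*} [Fintype V] [DecidableEq V]
    (π : SimplexOrdering V) (f : Simplex V → ℝ) :
    Fin (Fintype.card (Simplex V)) ≃ Simplex V :=
  (Tuple.sort (f ∘ π.enum)).trans π.enum

/-- The boundary matrix over `ℤ/2` of an enumeration of the simplices: the entry `(i, j)` is `1`
exactly when the `i`-th simplex is a face of codimension one of the `j`-th simplex. -/
def boundaryMatrix {V : Type*} [DecidableEq V] {n : ℕ} (s : Fin n → Simplex V) :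
    Matrix (Fin n) (Fin n) (ZMod 2) :=
  Matrix.of fun i j =>
    if (s i).1 ⊆ (s j).1 ∧ (s j).1.card = (s i).1.card + 1 then 1 else 0

/-! ### The standard column reduction algorithm -/

/-- The largest row index of a nonzero entry of a column, `⊥` for the zero column. -/
def low {n : ℕ} (c : Fin n → ZMod 2) : WithBot (Fin n) :=
  (Finset.univ.filter fun i => c i ≠ 0).max

open Classical in
/-- One pass of the inner loop of the standard algorithm for the column with index `j`, where
`prev` are the reduced columns to the left of it: if the current content `c` of the column is
nonzero and some column to the left has the same `low`, that column is added to `c`. -/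
noncomputable def reductionStep {n : ℕ} (j : Fin n)
    (prev : ∀ j' : Fin n, j' < j → Fin n → ZMod 2) (c : Fin n → ZMod 2) : Fin n → ZMod 2 :=
  if h : low c ≠ ⊥ ∧ ∃ j' : {j' : Fin n // j' < j}, low (prev j'.1 j'.2) = low c then
    c + prev h.2.choose.1 h.2.choose.2
  else c

/-- The `j`-th column of the matrix `R = D V` that the standard algorithm produces from `D`,
processing the columns from left to right. Every effective pass of the inner loop strictly lowers
`low`, so `n` passes exhaust the loop (further passes change nothing). -/
noncomputable def reducedColumn {n : ℕ} (D : Matrix (Fin n) (Fin n) (ZMod 2)) (j : Fin n) :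
    Fin n → ZMod 2 :=
  (reductionStep j fun j' (_ : j' < j) => reducedColumn D j')^[n] (fun i => D i j)
termination_by j

/-! ### Persistence pairs and birth edges -/

/-- `σ` and `τ` are paired, `low R (index of τ) = index of σ`, where `R` is the reduction of the
boundary matrix of the simplices, sorted by `f` with ties broken by `π`. -/
def IsPersistencePair {V : Type*} [Fintype V] [DecidableEq V] (f : Simplex V → ℝ)
    (π : SimplexOrdering V) (σ τ : Simplex V) : Prop :=
  low (reducedColumn (boundaryMatrix (π.sorted f)) ((π.sorted f).symm τ)) =
    ((π.sorted f).symm σ : WithBot (Fin (Fintype.card (Simplex V))))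

/-- The bars of the one-dimensional barcode of `d`, each given as the pair of its birth simplex `σ`
(of dimension one) and its death simplex `τ`; the bar is the nonempty interval from `ripsValue d σ`
to `ripsValue d τ`. Since the full complex on `V` has no one-dimensional homology, there are no
infinite bars. -/
def bcdOne {V : Type*} [Fintype V] [DecidableEq V] (d : V → V → ℝ) (π : SimplexOrdering V) :
    Set (Simplex V × Simplex V) :=
  {p | p.1.1.card = 2 ∧ IsPersistencePair (ripsValue d) π p.1 p.2 ∧
    ripsValue d p.1 < ripsValue d p.2}

/-- The birth edges of the one-dimensional barcode of `d`. -/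
def birthEdges {V : Type*} [Fintype V] [DecidableEq V] (d : V → V → ℝ) (π : SimplexOrdering V) :
    Set (Simplex V) :=
  {σ | ∃ τ, (σ, τ) ∈ bcdOne d π}

/-!
Chains are functions on simplices with values in `ℤ/2`, and the boundaries are the span of the
chains `faceChain τ`. The column reduction is used through two facts only: the reduced columns are
obtained from the boundary matrix by a unitriangular change, and the nonzero ones have distinct
`low`. Hence `σ` is paired exactly if it is the last simplex of some boundary, and its partner is
the earliest possible: every chain whose boundary ends in `σ` contains a simplex that does not come
before the partner (`exists_le_of_isLeading`).

If the chosen path between the ends of an edge `σ` has an intermediate vertex, then `σ` is the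
strictly longest edge of a triangle of the same filtration value, so `σ` dies at once. A birth edge
`σ` for `d₂` is therefore an edge of `G` with `d₂(σ) = W(σ)`, and cost-domination together with
`d₂ ≤ d₁` gives `d₁(σ) = W(σ)` as well (`ripsValue_eq_of_mem_bcdOne`). As ties are broken by the
same simplex ordering, every simplex that precedes `σ` in the first filtration precedes it in the
second one (`SimplexOrdering.sorted_symm_lt_of_le`).

* An edge is the last simplex of a boundary exactly if its ends are connected by earlier edges
  (`eqvGen_of_isLeading`, by counting edges of a cut modulo two, and `exists_isLeading_of_eqvGen`).
  An earlier edge of the second filtration can be replaced by the chosen path of `g₂` between its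
  ends, which consists of earlier edges of the first filtration
  (`eqvGen_edgeBefore_of_costDominated`). So `σ` is paired in the first filtration too.
* A chain that realizes the death of `σ` in the first filtration has a boundary ending in `σ` for
  the second filtration as well, which bounds the death time there (`ripsValue_death_le`). In
  particular the bar of `σ` for `d₁` is nonempty.

The argument works for every simplex ordering.
-/

/-! ### The column reduction over `ℤ/2` -/

lemma low_eq_coe_iff {n : ℕ} {c : Fin n → ZMod 2} {i : Fin n} :
    low c = (i : WithBot (Fin n)) ↔ c i ≠ 0 ∧ ∀ k, i < k → c k = 0 := by
  constructor
  · intro h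
    have hi : i ∈ Finset.univ.filter fun i => c i ≠ 0 := Finset.mem_of_max h
    refine ⟨by simpa using hi, fun k hk => ?_⟩
    by_contra hc
    have hle := Finset.le_max_of_eq (s := Finset.univ.filter fun i => c i ≠ 0)
      (a := k) (by simpa using hc) h
    exact absurd hk (not_lt.2 hle)
  · rintro ⟨h0, h1⟩
    refine le_antisymm (Finset.max_le fun k hk => ?_) (Finset.le_max (by simpa using h0))
    have hk' : c k ≠ 0 := by simpa using hk
    exact WithBot.coe_le_coe.2 (not_lt.1 fun h => hk' (h1 k h))

lemma low_lt_coe_iff {n : ℕ} {c : Fin n → ZMod 2} {i : Fin n} :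
    low c < (i : WithBot (Fin n)) ↔ ∀ k, i ≤ k → c k = 0 := by
  unfold low
  rw [Finset.max_eq_sup_withBot, Finset.sup_lt_iff (WithBot.bot_lt_coe i)]
  simp only [Finset.mem_filter, Finset.mem_univ, true_and, WithBot.coe_lt_coe]
  exact ⟨fun h k hk => by_contra fun hc => absurd (h k hc) (not_lt.2 hk),
    fun h k hc => not_le.1 fun hk => hc (h k hk)⟩

/-- Over `ℤ/2` the leading entries of two columns with the same `low` cancel. -/
lemma low_add_lt {n : ℕ} {c c' : Fin n → ZMod 2} (h0 : low c ≠ ⊥) (h : low c' = low c) :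
    low (c + c') < low c := by
  obtain ⟨i, hi⟩ := WithBot.ne_bot_iff_exists.1 h0
  rw [← hi] at h ⊢
  obtain ⟨a0, a1⟩ := low_eq_coe_iff.1 hi.symm
  obtain ⟨b0, b1⟩ := low_eq_coe_iff.1 h
  rw [low_lt_coe_iff]
  intro k hk
  rcases hk.eq_or_lt with rfl | hk
  · have key : ∀ x y : ZMod 2, x ≠ 0 → y ≠ 0 → x + y = 0 := by decide
    exact key _ _ a0 b0
  · simp [a1 k hk, b1 k hk]

/-- The loop of the reduction is effective at `c`: some column to the left has the same `low`. -/
def IsReducible {n : ℕ} (j : Fin n) (prev : ∀ j' : Fin n, j' < j → Fin n → ZMod 2)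
    (c : Fin n → ZMod 2) : Prop :=
  low c ≠ ⊥ ∧ ∃ j' : {j' : Fin n // j' < j}, low (prev j'.1 j'.2) = low c

lemma low_reductionStep_lt {n : ℕ} {j : Fin n} {prev : ∀ j' : Fin n, j' < j → Fin n → ZMod 2}
    {c : Fin n → ZMod 2} (h : IsReducible j prev c) : low (reductionStep j prev c) < low c := by
  unfold reductionStep
  split_ifs with h'
  · exact low_add_lt h.1 h'.2.choose_spec
  · exact absurd h h'

lemma reductionStep_of_not_isReducible {n : ℕ} {j : Fin n}
    {prev : ∀ j' : Fin n, j' < j → Fin n → ZMod 2}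
    {c : Fin n → ZMod 2} (h : ¬ IsReducible j prev c) : reductionStep j prev c = c := by
  unfold reductionStep
  exact dif_neg h

/-- A column whose nonzero entries all lie in the first `k` rows is fully reduced after `k`
passes. -/
lemma not_isReducible_iterate {n : ℕ} {j : Fin n}
    {prev : ∀ j' : Fin n, j' < j → Fin n → ZMod 2} (k : ℕ) :
    ∀ c : Fin n → ZMod 2, (∀ i : Fin n, low c = i → (i : ℕ) < k) →
      ¬ IsReducible j prev ((reductionStep j prev)^[k] c) := by
  induction k with
  | zero =>
    intro c hc h
    obtain ⟨i, hi⟩ := WithBot.ne_bot_iff_exists.1 h.1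
    exact absurd (hc i hi.symm) (Nat.not_lt_zero _)
  | succ k ih =>
    intro c hc
    by_cases h : IsReducible j prev c
    · rw [Function.iterate_succ_apply]
      refine ih _ fun i hi => ?_
      have hlt := low_reductionStep_lt h
      obtain ⟨i', hi'⟩ := WithBot.ne_bot_iff_exists.1 h.1
      have h1 := hc i' hi'.symm
      rw [hi, ← hi', WithBot.coe_lt_coe, Fin.lt_def] at hlt
      omega
    · rw [Function.iterate_fixed (reductionStep_of_not_isReducible h)]
      exact h

/-- Distinct nonzero reduced columns have distinct `low`. -/
lemma low_reducedColumn_ne {n : ℕ} (D : Matrix (Fin n) (Fin n) (ZMod 2)) {j' j : Fin n}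
    (hj : j' < j) (h0 : low (reducedColumn D j) ≠ ⊥) :
    low (reducedColumn D j') ≠ low (reducedColumn D j) := by
  intro h
  have key := not_isReducible_iterate (j := j) (prev := fun j' _ => reducedColumn D j') n
    (fun i => D i j) (fun i _ => i.2)
  rw [← reducedColumn] at key
  exact key ⟨h0, ⟨j', hj⟩, h⟩

lemma reductionStep_sub_mem {n : ℕ} {j : Fin n} {prev : ∀ j' : Fin n, j' < j → Fin n → ZMod 2}
    (M : Submodule (ZMod 2) (Fin n → ZMod 2)) (hM : ∀ j' hj', prev j' hj' ∈ M)
    (c : Fin n → ZMod 2) (k : ℕ) : (reductionStep j prev)^[k] c - c ∈ M := by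
  induction k with
  | zero => simp
  | succ k ih =>
    rw [Function.iterate_succ_apply']
    generalize (reductionStep j prev)^[k] c = b at ih
    unfold reductionStep
    split_ifs with h
    · rw [add_sub_right_comm]
      exact M.add_mem ih (hM _ _)
    · exact ih

/-- The reduction is unitriangular: a reduced column differs from the original one by a combination
of reduced columns further to the left. -/
lemma reducedColumn_sub_mem {n : ℕ} (D : Matrix (Fin n) (Fin n) (ZMod 2)) (j : Fin n)
    (M : Submodule (ZMod 2) (Fin n → ZMod 2)) (hM : ∀ j' < j, reducedColumn D j' ∈ M) :
    reducedColumn D j - D.col j ∈ M := by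
  rw [reducedColumn]
  exact reductionStep_sub_mem M hM _ n

lemma reducedColumn_mem_span {n : ℕ} (D : Matrix (Fin n) (Fin n) (ZMod 2)) (j : Fin n) :
    reducedColumn D j ∈ Submodule.span (ZMod 2) (D.col '' Set.Iic j) := by
  induction j using WellFoundedLT.induction with
  | ind j ih =>
    have h := reducedColumn_sub_mem D j (Submodule.span (ZMod 2) (D.col '' Set.Iic j))
      fun j' hj' => Submodule.span_mono (Set.image_mono (Set.Iic_subset_Iic.2 hj'.le)) (ih j' hj')
    have h' : D.col j ∈ Submodule.span (ZMod 2) (D.col '' Set.Iic j) :=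
      Submodule.subset_span ⟨j, Set.self_mem_Iic, rfl⟩
    simpa using Submodule.add_mem _ h h'

lemma col_mem_span_reducedColumn {n : ℕ} (D : Matrix (Fin n) (Fin n) (ZMod 2)) (j : Fin n) :
    D.col j ∈ Submodule.span (ZMod 2) (reducedColumn D '' Set.Iic j) := by
  have h := reducedColumn_sub_mem D j (Submodule.span (ZMod 2) (reducedColumn D '' Set.Iic j))
    fun j' hj' => Submodule.subset_span ⟨j', hj'.le, rfl⟩
  have h' : reducedColumn D j ∈ Submodule.span (ZMod 2) (reducedColumn D '' Set.Iic j) :=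
    Submodule.subset_span ⟨j, Set.self_mem_Iic, rfl⟩
  simpa using Submodule.sub_mem _ h' h

/-- As the nonzero reduced columns have distinct `low`, no cancellation of leading entries is
possible in their combinations. -/
lemma exists_low_eq_of_mem_span_reducedColumn {n : ℕ} (D : Matrix (Fin n) (Fin n) (ZMod 2))
    (S : Set (Fin n)) {v : Fin n → ZMod 2}
    (hv : v ∈ Submodule.span (ZMod 2) (reducedColumn D '' S)) {i : Fin n} (hi : low v = i) :
    ∃ j ∈ S, low (reducedColumn D j) = i := by
  obtain ⟨a, ha, rfl⟩ := (Finsupp.mem_span_image_iff_linearCombination _).1 hv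
  rw [Finsupp.linearCombination_apply, Finsupp.sum] at hi
  obtain ⟨hi0, hi1⟩ := low_eq_coe_iff.1 hi
  simp only [Finset.sum_apply, Pi.smul_apply, smul_eq_mul] at hi0 hi1
  obtain ⟨j₀, hj₀, hne⟩ := Finset.exists_ne_zero_of_sum_ne_zero hi0
  -- The largest `low` among the columns that occur is attained only once, so it survives in `v`.
  obtain ⟨j, hj, hmax⟩ :=
    a.support.exists_max_image (fun j => low (reducedColumn D j)) ⟨j₀, hj₀⟩
  have hle : (i : WithBot (Fin n)) ≤ low (reducedColumn D j) :=
    not_lt.1 fun hlt => right_ne_zero_of_mul hne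
      (low_lt_coe_iff.1 ((hmax j₀ hj₀).trans_lt hlt) i le_rfl)
  have h0 : low (reducedColumn D j) ≠ ⊥ := fun h => by simp [h] at hle
  obtain ⟨l, hl⟩ := WithBot.ne_bot_iff_exists.1 h0
  refine ⟨j, ha hj, ?_⟩
  rcases hle.eq_or_lt with h | h
  · exact h.symm
  · exfalso
    rw [← hl, WithBot.coe_lt_coe] at h
    have hz := hi1 l h
    rw [Finset.sum_eq_single_of_mem j hj] at hz
    · exact mul_ne_zero (Finsupp.mem_support_iff.1 hj) (low_eq_coe_iff.1 hl.symm).1 hz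
    · intro b hb hbj
      have hlt : low (reducedColumn D b) < l := by
        refine lt_of_le_of_ne (hl ▸ hmax b hb) fun hbl => ?_
        rw [hl] at hbl
        rcases lt_or_gt_of_ne hbj with hlt | hlt
        · exact low_reducedColumn_ne D hlt h0 hbl
        · exact low_reducedColumn_ne D hlt (hbl ▸ h0) hbl.symm
      rw [low_lt_coe_iff.1 hlt l le_rfl, mul_zero]

lemma exists_low_reducedColumn_eq {n : ℕ} (D : Matrix (Fin n) (Fin n) (ZMod 2))
    {v : Fin n → ZMod 2} (hv : v ∈ Submodule.span (ZMod 2) (Set.range D.col)) {i : Fin n}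
    (hi : low v = i) : ∃ j, low (reducedColumn D j) = i := by
  have hle : Submodule.span (ZMod 2) (Set.range D.col) ≤
      Submodule.span (ZMod 2) (reducedColumn D '' Set.univ) := by
    rw [Submodule.span_le]
    rintro _ ⟨j, rfl⟩
    exact Submodule.span_mono (Set.image_mono (Set.subset_univ _)) (col_mem_span_reducedColumn D j)
  obtain ⟨j, -, hj⟩ := exists_low_eq_of_mem_span_reducedColumn D Set.univ (hle hv) hi
  exact ⟨j, hj⟩

/-- Minimality of the column paired with `i`: a combination of columns of `D` whose `low` is `i`
involves a column that is not to the left of the one paired with `i`. -/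
lemma exists_le_of_low_reducedColumn_eq {n : ℕ} (D : Matrix (Fin n) (Fin n) (ZMod 2))
    {i j : Fin n} (hj : low (reducedColumn D j) = i) {S : Set (Fin n)} {v : Fin n → ZMod 2}
    (hv : v ∈ Submodule.span (ZMod 2) (D.col '' S)) (hi : low v = i) : ∃ k ∈ S, j ≤ k := by
  by_contra! hS
  have hle : Submodule.span (ZMod 2) (D.col '' S) ≤
      Submodule.span (ZMod 2) (reducedColumn D '' Set.Iio j) := by
    rw [Submodule.span_le]
    rintro _ ⟨k, hk, rfl⟩
    exact Submodule.span_mono (Set.image_mono fun l hl => lt_of_le_of_lt hl (hS k hk))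
      (col_mem_span_reducedColumn D k)
  obtain ⟨k, hk, hki⟩ := exists_low_eq_of_mem_span_reducedColumn D (Set.Iio j) (hle hv) hi
  exact low_reducedColumn_ne D hk (by simp [hj]) (hki.trans hj.symm)

/-! ### Chains and persistence pairs -/

/-- The boundary of a simplex as a chain over `ℤ/2`: the indicator function of its faces of
codimension one. Chains are functions on simplices, so that they do not depend on an order. -/
def faceChain {V : Type*} [DecidableEq V] (τ σ : Simplex V) : ZMod 2 :=
  if σ.1 ⊆ τ.1 ∧ τ.1.card = σ.1.card + 1 then 1 else 0

/-- The simplex `σ` is the last one of the chain `v` in the enumeration `s`. -/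
def IsLeading {V : Type*} {n : ℕ} (s : Fin n ≃ Simplex V) (v : Simplex V → ZMod 2)
    (σ : Simplex V) : Prop :=
  v σ ≠ 0 ∧ ∀ ρ, s.symm σ < s.symm ρ → v ρ = 0

section Chains

variable {V : Type*} [DecidableEq V] {n : ℕ}

omit [DecidableEq V] in
lemma low_comp_eq_iff (s : Fin n ≃ Simplex V) (v : Simplex V → ZMod 2) (σ : Simplex V) :
    low (v ∘ s) = (s.symm σ : WithBot (Fin n)) ↔ IsLeading s v σ := by
  rw [low_eq_coe_iff, IsLeading, ← s.forall_congr_right]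
  simp

lemma comp_mem_span_col_iff (s : Fin n ≃ Simplex V) (v : Simplex V → ZMod 2) (S : Set (Fin n)) :
    v ∘ s ∈ Submodule.span (ZMod 2) ((boundaryMatrix s).col '' S) ↔
      v ∈ Submodule.span (ZMod 2) (faceChain '' (s '' S)) := by
  have himg : (boundaryMatrix s).col '' S =
      LinearEquiv.funCongrLeft (ZMod 2) (ZMod 2) s '' (faceChain '' (s '' S)) := by
    rw [Set.image_image, Set.image_image]
    rfl
  rw [himg, ← LinearEquiv.coe_coe, ← Submodule.map_span]
  change LinearEquiv.funCongrLeft (ZMod 2) (ZMod 2) s v ∈ _ ↔ _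
  rw [← LinearEquiv.coe_coe, Submodule.mem_map]
  refine ⟨?_, fun h => ⟨v, h, rfl⟩⟩
  rintro ⟨w, hw, hwv⟩
  rwa [← (LinearEquiv.funCongrLeft (ZMod 2) (ZMod 2) s).injective hwv]

lemma exists_isLeading_of_low_eq (s : Fin n ≃ Simplex V) {σ τ : Simplex V}
    (h : low (reducedColumn (boundaryMatrix s) (s.symm τ)) = (s.symm σ : WithBot (Fin n))) :
    ∃ v ∈ Submodule.span (ZMod 2) (faceChain '' {ρ | s.symm ρ ≤ s.symm τ}), IsLeading s v σ := by
  set r := reducedColumn (boundaryMatrix s) (s.symm τ) with hr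
  have hrs : (r ∘ s.symm) ∘ s = r := by ext; simp
  refine ⟨r ∘ s.symm, ?_, ?_⟩
  · have himg : {ρ | s.symm ρ ≤ s.symm τ} = s '' Set.Iic (s.symm τ) := by
      rw [s.image_eq_preimage_symm]; rfl
    rw [himg, ← comp_mem_span_col_iff, hrs]
    exact reducedColumn_mem_span _ _
  · rwa [← low_comp_eq_iff, hrs]

lemma exists_le_of_isLeading (s : Fin n ≃ Simplex V) {σ τ : Simplex V}
    (h : low (reducedColumn (boundaryMatrix s) (s.symm τ)) = (s.symm σ : WithBot (Fin n)))
    {S : Set (Simplex V)} {v : Simplex V → ZMod 2}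
    (hv : v ∈ Submodule.span (ZMod 2) (faceChain '' S)) (hσ : IsLeading s v σ) :
    ∃ ρ ∈ S, s.symm τ ≤ s.symm ρ := by
  have hS : s '' (s ⁻¹' S) = S := Set.image_preimage_eq _ s.surjective
  rw [← hS, ← comp_mem_span_col_iff] at hv
  obtain ⟨k, hk, hle⟩ :=
    exists_le_of_low_reducedColumn_eq _ h hv ((low_comp_eq_iff s v σ).2 hσ)
  exact ⟨s k, hk, by simpa using hle⟩

lemma exists_low_eq_of_isLeading (s : Fin n ≃ Simplex V) {σ : Simplex V}
    {v : Simplex V → ZMod 2} (hv : v ∈ Submodule.span (ZMod 2) (Set.range faceChain))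
    (hσ : IsLeading s v σ) :
    ∃ τ, low (reducedColumn (boundaryMatrix s) (s.symm τ)) = (s.symm σ : WithBot (Fin n)) := by
  have hr : Set.range (faceChain (V := V)) = faceChain '' (s '' Set.univ) := by
    rw [Set.image_univ, s.range_eq_univ, Set.image_univ]
  rw [hr, ← comp_mem_span_col_iff, Set.image_univ] at hv
  obtain ⟨k, hk⟩ := exists_low_reducedColumn_eq _ hv ((low_comp_eq_iff s v σ).2 hσ)
  exact ⟨s k, by simpa using hk⟩

/-! ### Edges, triangles and connectivity -/

/-- The simplex with vertices `a` and `b`, an edge if `a ≠ b`. -/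
def edgeSimplex (a b : V) : Simplex V := ⟨{a, b}, Finset.insert_nonempty _ _⟩

/-- The simplex with vertices `a`, `b` and `c`. -/
def triangleSimplex (a b c : V) : Simplex V := ⟨{a, b, c}, Finset.insert_nonempty _ _⟩

lemma edgeSimplex_comm (a b : V) : edgeSimplex a b = edgeSimplex b a :=
  Subtype.ext (Finset.pair_comm a b)

lemma exists_eq_edgeSimplex {σ : Simplex V} (h : σ.1.card = 2) :
    ∃ a b, a ≠ b ∧ σ = edgeSimplex a b := by
  obtain ⟨a, b, hab, hσ⟩ := Finset.card_eq_two.1 h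
  exact ⟨a, b, hab, Subtype.ext hσ⟩

lemma faceChain_triangleSimplex {a b c : V} (hab : a ≠ b) (hac : a ≠ c) (hbc : b ≠ c) :
    faceChain (triangleSimplex a b c) =
      Pi.single (edgeSimplex a b) 1 + Pi.single (edgeSimplex a c) 1 +
        Pi.single (edgeSimplex b c) 1 := by
  have h1 : edgeSimplex a b ≠ edgeSimplex a c := fun h => by
    have : b ∈ (edgeSimplex a c).1 := h ▸ by simp [edgeSimplex]
    simp [edgeSimplex, hab.symm, hbc] at this
  have h2 : edgeSimplex a b ≠ edgeSimplex b c := fun h => by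
    have : a ∈ (edgeSimplex b c).1 := h ▸ by simp [edgeSimplex]
    simp [edgeSimplex, hab, hac] at this
  have h3 : edgeSimplex a c ≠ edgeSimplex b c := fun h => by
    have : a ∈ (edgeSimplex b c).1 := h ▸ by simp [edgeSimplex]
    simp [edgeSimplex, hab, hac] at this
  have hface : ∀ σ : Simplex V,
      (σ.1 ⊆ (triangleSimplex a b c).1 ∧ (triangleSimplex a b c).1.card = σ.1.card + 1) ↔
        σ = edgeSimplex a b ∨ σ = edgeSimplex a c ∨ σ = edgeSimplex b c := by
    intro σ
    have hcard : (triangleSimplex a b c).1.card = 3 := Finset.card_eq_three.2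
      ⟨a, b, c, hab, hac, hbc, rfl⟩
    constructor
    · rintro ⟨hsub, hc⟩
      obtain ⟨x, hx, hxσ⟩ := Finset.exists_eq_insert_iff.2 ⟨hsub, hc.symm⟩
      have hσ : σ.1 = (triangleSimplex a b c).1.erase x := by
        rw [← hxσ, Finset.erase_insert hx]
      have hxt : x ∈ (triangleSimplex a b c).1 := hxσ ▸ Finset.mem_insert_self _ _
      simp only [triangleSimplex, Finset.mem_insert, Finset.mem_singleton] at hxt
      rcases hxt with rfl | rfl | rfl
      · refine Or.inr (Or.inr (Subtype.ext (hσ.trans ?_)))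
        ext y; simp only [triangleSimplex, edgeSimplex, Finset.mem_erase, Finset.mem_insert,
          Finset.mem_singleton]; grind
      · refine Or.inr (Or.inl (Subtype.ext (hσ.trans ?_)))
        ext y; simp only [triangleSimplex, edgeSimplex, Finset.mem_erase, Finset.mem_insert,
          Finset.mem_singleton]; grind
      · refine Or.inl (Subtype.ext (hσ.trans ?_))
        ext y; simp only [triangleSimplex, edgeSimplex, Finset.mem_erase, Finset.mem_insert,
          Finset.mem_singleton]; grind
    · rw [hcard]
      rintro (rfl | rfl | rfl)
      · refine ⟨?_, by simp [edgeSimplex, hab]⟩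
        intro y; simp only [triangleSimplex, edgeSimplex, Finset.mem_insert,
          Finset.mem_singleton]; tauto
      · refine ⟨?_, by simp [edgeSimplex, hac]⟩
        intro y; simp only [triangleSimplex, edgeSimplex, Finset.mem_insert,
          Finset.mem_singleton]; tauto
      · refine ⟨?_, by simp [edgeSimplex, hbc]⟩
        intro y; simp only [triangleSimplex, edgeSimplex, Finset.mem_insert,
          Finset.mem_singleton]; tauto
  ext σ
  unfold faceChain
  simp only [hface, Pi.add_apply, Pi.single_apply]
  by_cases e1 : σ = edgeSimplex a b
  · subst e1; simp [h1, h2]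
  · by_cases e2 : σ = edgeSimplex a c
    · subst e2; simp [h1.symm, h3]
    · simp [e1, e2]

/-- The coboundary of the indicator function of `A`: on edges, the indicator function of the cut
between `A` and its complement. -/
noncomputable def cutCoeff (A : Set V) (σ : Simplex V) : ZMod 2 :=
  if σ.1.card = 2 then ∑ a ∈ σ.1, A.indicator 1 a else 0

lemma cutCoeff_edgeSimplex (A : Set V) {a b : V} (hab : a ≠ b) :
    cutCoeff A (edgeSimplex a b) = A.indicator 1 a + A.indicator 1 b := by
  have hc : (edgeSimplex a b).1.card = 2 := Finset.card_pair hab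
  rw [cutCoeff, if_pos hc]
  exact Finset.sum_pair hab

/-- The number, modulo two, of edges of a chain with exactly one end in `A`. -/
noncomputable def cutParity [Fintype V] (A : Set V) : (Simplex V → ZMod 2) →ₗ[ZMod 2] ZMod 2 :=
  ∑ σ : Simplex V, cutCoeff A σ • LinearMap.proj σ

omit [DecidableEq V] in
lemma cutParity_apply [Fintype V] (A : Set V) (v : Simplex V → ZMod 2) :
    cutParity A v = ∑ σ : Simplex V, cutCoeff A σ * v σ := by
  simp [cutParity]

lemma cutParity_single_edgeSimplex [Fintype V] (A : Set V) {a b : V} (hab : a ≠ b) :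
    cutParity A (Pi.single (edgeSimplex a b) 1) = A.indicator 1 a + A.indicator 1 b := by
  rw [cutParity_apply, Finset.sum_eq_single (edgeSimplex a b), cutCoeff_edgeSimplex A hab]
  · simp
  · intro σ _ hσ
    simp [hσ]
  · simp

/-- A triangle meets every cut in an even number of edges. -/
lemma cutParity_faceChain [Fintype V] (A : Set V) (τ : Simplex V) :
    cutParity A (faceChain τ) = 0 := by
  by_cases h : τ.1.card = 3
  · obtain ⟨a, b, c, hab, hac, hbc, hτ⟩ := Finset.card_eq_three.1 h
    obtain rfl : τ = triangleSimplex a b c := Subtype.ext hτ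
    rw [faceChain_triangleSimplex hab hac hbc, map_add, map_add, cutParity_single_edgeSimplex A hab,
      cutParity_single_edgeSimplex A hac, cutParity_single_edgeSimplex A hbc]
    have key : ∀ x y z : ZMod 2, x + y + (x + z) + (y + z) = 0 := by decide
    exact key _ _ _
  · rw [cutParity_apply]
    refine Finset.sum_eq_zero fun σ _ => ?_
    by_cases hσ : σ.1.card = 2
    · have : ¬ (σ.1 ⊆ τ.1 ∧ τ.1.card = σ.1.card + 1) := fun h' => h (by omega)
      rw [faceChain, if_neg this, mul_zero]
    · rw [cutCoeff, if_neg hσ, zero_mul]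

/-- `x` and `y` span an edge that precedes the simplex `σ`. -/
def EdgeBefore (s : Fin n ≃ Simplex V) (σ : Simplex V) (x y : V) : Prop :=
  x ≠ y ∧ s.symm (edgeSimplex x y) < s.symm σ

/-- If an edge is the last simplex of a boundary, then its ends are connected by earlier edges:
otherwise the boundary would meet the cut around a connected component exactly once. -/
lemma eqvGen_of_isLeading [Fintype V] (s : Fin n ≃ Simplex V) {a b : V} (hab : a ≠ b)
    {v : Simplex V → ZMod 2} (hv : v ∈ Submodule.span (ZMod 2) (Set.range faceChain))
    (h : IsLeading s v (edgeSimplex a b)) :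
    Relation.EqvGen (EdgeBefore s (edgeSimplex a b)) a b := by
  by_contra hb
  set A : Set V := {x | Relation.EqvGen (EdgeBefore s (edgeSimplex a b)) a x} with hA
  have hcut : cutParity A v = 0 := by
    have hle : Submodule.span (ZMod 2) (Set.range faceChain) ≤ LinearMap.ker (cutParity A) := by
      rw [Submodule.span_le]
      rintro _ ⟨τ, rfl⟩
      exact cutParity_faceChain A τ
    exact hle hv
  have haA : a ∈ A := Relation.EqvGen.refl a
  have hbA : b ∉ A := hb
  rw [cutParity_apply, Finset.sum_eq_single (edgeSimplex a b)] at hcut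
  · refine h.1 ?_
    simpa [cutCoeff_edgeSimplex A hab, haA, hbA] using hcut
  · intro σ _ hσ
    by_cases hc : σ.1.card = 2
    · rcases lt_or_gt_of_ne (s.symm.injective.ne hσ) with hlt | hlt
      · obtain ⟨x, y, hxy, rfl⟩ := exists_eq_edgeSimplex hc
        have hR : EdgeBefore s (edgeSimplex a b) x y := ⟨hxy, hlt⟩
        have hiff : x ∈ A ↔ y ∈ A :=
          ⟨fun hx => hx.trans _ _ _ (.rel _ _ hR), fun hy => hy.trans _ _ _ (.symm _ _ (.rel _ _ hR))⟩
        have h2 : ∀ z : ZMod 2, z + z = 0 := by decide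
        have hind : A.indicator (1 : V → ZMod 2) x = A.indicator 1 y := by
          by_cases hy : y ∈ A
          · simp [hy, hiff.2 hy]
          · simp [hy, mt hiff.1 hy]
        rw [cutCoeff_edgeSimplex A hxy, hind, h2, zero_mul]
      · rw [h.2 σ hlt, mul_zero]
    · rw [cutCoeff, if_neg hc, zero_mul]
  · simp

/-- Conversely, an edge whose ends are connected by earlier edges is the last simplex of a boundary:
a cycle through that edge and the earlier ones bounds in the full complex. -/
lemma exists_isLeading_of_eqvGen (s : Fin n ≃ Simplex V) {a b : V} (hab : a ≠ b)
    (h : Relation.EqvGen (EdgeBefore s (edgeSimplex a b)) a b) :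
    ∃ v ∈ Submodule.span (ZMod 2) (Set.range faceChain), IsLeading s v (edgeSimplex a b) := by
  let B : Submodule (ZMod 2) (Simplex V → ZMod 2) :=
    { carrier := {v | ∀ ρ, s.symm (edgeSimplex a b) ≤ s.symm ρ → v ρ = 0}
      add_mem' := fun hv hw ρ hρ => by simp [hv ρ hρ, hw ρ hρ]
      zero_mem' := fun _ _ => rfl
      smul_mem' := fun c v hv ρ hρ => by simp [hv ρ hρ] }
  -- `B` consists of the chains of simplices before the edge `a b`, and `M` of the sums of a boundary
  -- and such a chain. That an edge lies in `M` is a transitive relation between its ends.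
  let M := Submodule.span (ZMod 2) (Set.range (faceChain (V := V))) ⊔ B
  have key : ∀ x y, Relation.EqvGen (EdgeBefore s (edgeSimplex a b)) x y →
      x = y ∨ Pi.single (edgeSimplex x y) 1 ∈ M := by
    intro x y hxy
    induction hxy with
    | rel x y hxy =>
      refine Or.inr (Submodule.mem_sup_right fun ρ hρ => ?_)
      refine Pi.single_eq_of_ne ?_ _
      rintro rfl
      exact absurd hxy.2 (not_lt.2 hρ)
    | refl x => exact Or.inl rfl
    | symm x y _ ih => rwa [edgeSimplex_comm, eq_comm]
    | trans x y z _ _ ih₁ ih₂ =>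
      rcases ih₁ with rfl | h₁
      · exact ih₂
      rcases ih₂ with rfl | h₂
      · exact Or.inr h₁
      by_cases hxy : x = y
      · exact hxy ▸ Or.inr h₂
      by_cases hyz : y = z
      · exact hyz ▸ Or.inr h₁
      by_cases hxz : x = z
      · exact Or.inl hxz
      -- The third side of a triangle differs from the sum of the other two by a boundary.
      have ht : faceChain (triangleSimplex x y z) ∈ M :=
        Submodule.mem_sup_left (Submodule.subset_span ⟨_, rfl⟩)
      rw [faceChain_triangleSimplex hxy hxz hyz] at ht
      have := M.sub_mem (M.sub_mem ht h₁) h₂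
      rw [add_sub_right_comm, add_sub_cancel_right, add_sub_cancel_left] at this
      exact Or.inr this
  obtain ⟨v, hv, w, hw, hvw⟩ := Submodule.mem_sup.1 ((key a b h).resolve_left hab)
  have hval : ∀ ρ, s.symm (edgeSimplex a b) ≤ s.symm ρ →
      v ρ = (Pi.single (edgeSimplex a b) 1 : Simplex V → ZMod 2) ρ := fun ρ hρ => by
    rw [← hvw, Pi.add_apply, hw ρ hρ, add_zero]
  refine ⟨v, hv, ?_, fun ρ hρ => ?_⟩
  · rw [hval _ le_rfl]; simp
  · rw [hval ρ hρ.le]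
    refine Pi.single_eq_of_ne ?_ _
    rintro rfl
    exact lt_irrefl _ hρ

end Chains

/-! ### The filtration order -/

section Order

variable {V : Type*} [Fintype V] [DecidableEq V]

/-- The sorted enumeration is the lexicographic order by `f` and the simplex ordering. -/
lemma SimplexOrdering.sorted_symm_lt_iff (π : SimplexOrdering V) (f : Simplex V → ℝ)
    (σ τ : Simplex V) : (π.sorted f).symm σ < (π.sorted f).symm τ ↔
      f σ < f τ ∨ f σ = f τ ∧ π.enum.symm σ < π.enum.symm τ := by
  obtain ⟨hmono, htie⟩ := Tuple.eq_sort_iff.1 (Eq.refl (Tuple.sort (f ∘ π.enum)))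
  have hf : ∀ ρ, (f ∘ π.enum) (Tuple.sort (f ∘ π.enum) ((π.sorted f).symm ρ)) = f ρ := fun ρ => by
    simp [SimplexOrdering.sorted]
  have hi : ∀ ρ, Tuple.sort (f ∘ π.enum) ((π.sorted f).symm ρ) = π.enum.symm ρ := fun ρ => by
    simp [SimplexOrdering.sorted]
  have key : ∀ σ τ, (π.sorted f).symm σ < (π.sorted f).symm τ →
      f σ < f τ ∨ f σ = f τ ∧ π.enum.symm σ < π.enum.symm τ := fun σ τ h => by
    have h1 := hmono h.le
    have h2 := htie _ _ h
    rw [hf, hf, hi, hi] at h2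
    change (f ∘ π.enum) _ ≤ (f ∘ π.enum) _ at h1
    rw [hf, hf] at h1
    exact h1.lt_or_eq.imp id fun he => ⟨he, h2 he⟩
  refine ⟨key σ τ, fun h => ?_⟩
  rcases lt_trichotomy ((π.sorted f).symm σ) ((π.sorted f).symm τ) with hlt | heq | hgt
  · exact hlt
  · obtain rfl := (π.sorted f).symm.injective heq
    simp at h
  · rcases h with h | h <;> rcases key τ σ hgt with h' | h'
    · exact absurd h h'.not_gt
    · exact absurd h'.1 h.ne'
    · exact absurd h.1 h'.ne'
    · exact absurd h.2 h'.2.not_gt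

lemma SimplexOrdering.le_of_sorted_symm_le (π : SimplexOrdering V) (f : Simplex V → ℝ)
    {σ τ : Simplex V} (h : (π.sorted f).symm σ ≤ (π.sorted f).symm τ) : f σ ≤ f τ :=
  not_lt.1 fun hlt => absurd ((π.sorted_symm_lt_iff f τ σ).2 (Or.inl hlt)) (not_lt.2 h)

/-- The simplices before `σ` in the first filtration are before `σ` in the second one, if the second
filtration function is smaller and both agree at `σ`. -/
lemma SimplexOrdering.sorted_symm_lt_of_le (π : SimplexOrdering V) {f₁ f₂ : Simplex V → ℝ}
    {σ ρ : Simplex V} (hρ : f₂ ρ ≤ f₁ ρ) (hσ : f₁ σ = f₂ σ)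
    (h : (π.sorted f₂).symm σ < (π.sorted f₂).symm ρ) :
    (π.sorted f₁).symm σ < (π.sorted f₁).symm ρ := by
  rw [SimplexOrdering.sorted_symm_lt_iff] at h ⊢
  rw [hσ]
  rcases h with h | ⟨h, hπ⟩
  · exact Or.inl (h.trans_le hρ)
  · rcases (h.le.trans hρ).lt_or_eq with h' | h'
    · exact Or.inl h'
    · exact Or.inr ⟨h', hπ⟩

/-- Ordering the simplices by their dimension gives a simplex ordering. -/
lemma SimplexOrdering.exists_simplexOrdering (V : Type*) [Fintype V] [DecidableEq V] :
    Nonempty (SimplexOrdering V) := by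
  let e : Fin (Fintype.card (Simplex V)) ≃ Simplex V := (Fintype.equivFin _).symm
  let c : Simplex V → ℕ := fun σ => σ.1.card
  refine ⟨⟨(Tuple.sort (c ∘ e)).trans e, fun σ τ h => not_le.1 fun hle => ?_⟩⟩
  have := Tuple.monotone_sort (c ∘ e) hle
  simp only [Function.comp_apply, Equiv.symm_trans_apply, Equiv.apply_symm_apply] at this
  exact absurd (Finset.card_lt_card h) (not_lt.2 this)

end Order

lemma ripsValue_mono {V : Type*} {d₁ d₂ : V → V → ℝ} (h : ∀ v w, d₂ v w ≤ d₁ v w)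
    (σ : Simplex V) : ripsValue d₂ σ ≤ ripsValue d₁ σ :=
  Finset.sup'_mono_fun fun p _ => h p.1 p.2

lemma ripsValue_le_iff {V : Type*} {d : V → V → ℝ} {σ : Simplex V} {t : ℝ} :
    ripsValue d σ ≤ t ↔ ∀ v ∈ σ.1, ∀ w ∈ σ.1, d v w ≤ t := by
  simp only [ripsValue, Finset.sup'_le_iff, Finset.mem_product, Prod.forall]
  exact ⟨fun h v hv w hw => h v w ⟨hv, hw⟩, fun h v w hvw => h v hvw.1 w hvw.2⟩

/-! ### Path-representable distances -/

section Walks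

variable {V : Type*} {G : SimpleGraph V} {W : Sym2 V → ℝ} (hW : ∀ e ∈ G.edgeSet, 0 < W e)

include hW

lemma walkWeight_nonneg {v w : V} (p : G.Walk v w) : 0 ≤ (p.edges.map W).sum := by
  refine List.sum_nonneg fun x hx => ?_
  obtain ⟨e, he, rfl⟩ := List.mem_map.1 hx
  exact (hW e (p.edges_subset_edgeSet he)).le

/-- An edge of a walk is strictly cheaper than the walk, unless it is the whole walk. -/
lemma weight_lt_or_eq_of_mem_edges {v w : V} (p : G.Walk v w) {e : Sym2 V} (he : e ∈ p.edges) :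
    W e < (p.edges.map W).sum ∨ e = s(v, w) ∧ W e = (p.edges.map W).sum := by
  induction p with
  | nil => simp at he
  | @cons v x w h q ih =>
    have hvx : 0 < W s(v, x) := hW _ h
    rw [SimpleGraph.Walk.edges_cons, List.map_cons, List.sum_cons]
    rcases List.mem_cons.1 he with rfl | he'
    · cases q with
      | nil => right; simp
      | cons h' q' =>
        left
        change W s(v, x) < _
        have := hW _ (G.mem_edgeSet.2 h')
        have := walkWeight_nonneg hW q'
        rw [SimpleGraph.Walk.edges_cons, List.map_cons, List.sum_cons]
        linarith
    · left
      rcases ih he' with h' | ⟨-, h'⟩ <;> linarith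

end Walks

namespace PathChoice

variable {V : Type*} {G : SimpleGraph V}

lemma dist_self (g : PathChoice G) (W : Sym2 V → ℝ) (v : V) : g.dist W v v = 0 := by
  rw [dist, SimpleGraph.Walk.edges_eq_nil.2 (SimpleGraph.Walk.isPath_iff_nil.1 (g.isPath v v)),
    List.map_nil, List.sum_nil]

lemma dist_comm (g : PathChoice G) (W : Sym2 V → ℝ) (v w : V) : g.dist W v w = g.dist W w v := by
  rw [dist, dist, g.symm v w, SimpleGraph.Walk.edges_reverse, List.map_reverse, List.sum_reverse]

lemma dist_nonneg (g : PathChoice G) {W : Sym2 V → ℝ} (hW : ∀ e ∈ G.edgeSet, 0 < W e) (v w : V) :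
    0 ≤ g.dist W v w :=
  walkWeight_nonneg hW _

lemma ripsValue_edgeSimplex [DecidableEq V] (g : PathChoice G) {W : Sym2 V → ℝ}
    (hW : ∀ e ∈ G.edgeSet, 0 < W e) (v w : V) :
    ripsValue (g.dist W) (edgeSimplex v w) = g.dist W v w := by
  refine le_antisymm (ripsValue_le_iff.2 fun x hx y hy => ?_)
    (ripsValue_le_iff.1 le_rfl v (by simp [edgeSimplex]) w (by simp [edgeSimplex]))
  have h0 := g.dist_nonneg hW v w
  simp only [edgeSimplex, Finset.mem_insert, Finset.mem_singleton] at hx hy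
  rcases hx with rfl | rfl <;> rcases hy with rfl | rfl
  · rwa [g.dist_self]
  · exact le_rfl
  · exact (g.dist_comm W _ _).le
  · rwa [g.dist_self]

/-- Two distinct vertices are either joined by an edge that is the chosen path, or there is an
intermediate vertex that is strictly closer to both of them. -/
lemma dist_eq_weight_or_exists_closer (g : PathChoice G) {W : Sym2 V → ℝ}
    (hW : ∀ e ∈ G.edgeSet, 0 < W e) {v w : V} (hvw : v ≠ w) :
    (G.Adj v w ∧ g.dist W v w = W s(v, w)) ∨
      ∃ x, g.dist W v x < g.dist W v w ∧ g.dist W x w < g.dist W v w := by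
  have hcons := g.consistent v w
  unfold dist
  cases hp : g.path v w with
  | nil => exact absurd rfl hvw
  | @cons _ x _ h q =>
    rw [hp] at hcons
    cases q with
    | nil => exact Or.inl ⟨h, by simp⟩
    | @cons _ y _ h' q' =>
      refine Or.inr ⟨x, ?_, ?_⟩
      · rw [hcons v x (.cons h .nil) ⟨.nil, .cons h' q', by simp⟩]
        have := hW _ (G.mem_edgeSet.2 h')
        have := walkWeight_nonneg hW q'
        simp
        linarith
      · rw [hcons x w (.cons h' q') (SimpleGraph.Walk.isSubwalk_cons _ _)]
        have := hW _ (G.mem_edgeSet.2 h)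
        simpa using this

end PathChoice

/-! ### Birth edges -/

section Birth

variable {V : Type*} [Fintype V] [DecidableEq V] {G : SimpleGraph V} {W : Sym2 V → ℝ}
  (hW : ∀ e ∈ G.edgeSet, 0 < W e)

include hW

/-- A birth edge is an edge of the graph that is its own chosen path. Otherwise it is the longest
edge of a triangle that enters the filtration together with it and kills it. -/
lemma exists_adj_of_mem_bcdOne (g : PathChoice G) (π : SimplexOrdering V) {σ τ : Simplex V}
    (h : (σ, τ) ∈ bcdOne (g.dist W) π) :
    ∃ a b, G.Adj a b ∧ g.dist W a b = W s(a, b) ∧ σ = edgeSimplex a b := by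
  obtain ⟨hσ, hpair, hlt⟩ := h
  obtain ⟨a, b, hab, rfl⟩ := exists_eq_edgeSimplex hσ
  rcases g.dist_eq_weight_or_exists_closer hW hab with ⟨hadj, hd⟩ | ⟨x, hax, hxb⟩
  · exact ⟨a, b, hadj, hd, rfl⟩
  exfalso
  have hxa : a ≠ x := by rintro rfl; exact lt_irrefl _ hxb
  have hxb' : x ≠ b := by rintro rfl; exact lt_irrefl _ hax
  have hlead : IsLeading (π.sorted (ripsValue (g.dist W))) (faceChain (triangleSimplex a x b))
      (edgeSimplex a b) := by
    have hne : ∀ y z, g.dist W y z < g.dist W a b → ∀ ρ : Simplex V,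
        (π.sorted (ripsValue (g.dist W))).symm (edgeSimplex a b) ≤
          (π.sorted (ripsValue (g.dist W))).symm ρ → ρ ≠ edgeSimplex y z := by
      rintro y z hyz ρ hρ rfl
      have := π.le_of_sorted_symm_le _ hρ
      rw [g.ripsValue_edgeSimplex hW, g.ripsValue_edgeSimplex hW] at this
      exact absurd hyz (not_lt.2 this)
    rw [faceChain_triangleSimplex hxa hab hxb']
    constructor
    · simp [hne a x hax _ le_rfl, hne x b hxb _ le_rfl]
    · intro ρ hρ
      have hρ' : ρ ≠ edgeSimplex a b := by rintro rfl; exact lt_irrefl _ hρ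
      simp [hne a x hax _ hρ.le, hne x b hxb _ hρ.le, hρ']
  obtain ⟨ρ, hρ, hle⟩ := exists_le_of_isLeading _ hpair (S := {triangleSimplex a x b})
    (Submodule.subset_span ⟨_, rfl, rfl⟩) hlead
  obtain rfl : ρ = triangleSimplex a x b := hρ
  refine absurd hlt (not_lt.2 ((π.le_of_sorted_symm_le _ hle).trans (ripsValue_le_iff.2 ?_)))
  rw [g.ripsValue_edgeSimplex hW]
  have h0 := g.dist_nonneg hW a b
  intro y hy z hz
  simp only [triangleSimplex, Finset.mem_insert, Finset.mem_singleton] at hy hz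
  rcases hy with rfl | rfl | rfl <;> rcases hz with rfl | rfl | rfl <;>
    first
    | exact (g.dist_self W _).le.trans h0
    | exact le_rfl
    | exact hax.le
    | exact hxb.le
    | exact (g.dist_comm W _ _).le
    | exact (g.dist_comm W _ _).le.trans hax.le
    | exact (g.dist_comm W _ _).le.trans hxb.le

/-- Vertices connected before the edge `σ` in the second filtration are connected before `σ` in the
first one: an edge of the second filtration is replaced by the chosen path between its ends, whose
edges enter the first filtration in time because `g₁` is cost-dominated. -/
lemma eqvGen_edgeBefore_of_costDominated {g₁ g₂ : PathChoice G} (hg₁ : g₁.CostDominated W)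
    (π : SimplexOrdering V) {σ : Simplex V}
    (hσ : ripsValue (g₁.dist W) σ = ripsValue (g₂.dist W) σ) {a b : V}
    (h : Relation.EqvGen (EdgeBefore (π.sorted (ripsValue (g₂.dist W))) σ) a b) :
    Relation.EqvGen (EdgeBefore (π.sorted (ripsValue (g₁.dist W))) σ) a b := by
  have hwalk : ∀ {x y : V} (p : G.Walk x y),
      (∀ u v, s(u, v) ∈ p.edges → EdgeBefore (π.sorted (ripsValue (g₁.dist W))) σ u v) →
        Relation.EqvGen (EdgeBefore (π.sorted (ripsValue (g₁.dist W))) σ) x y := by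
    intro x y p hp
    induction p with
    | nil => exact .refl _
    | cons h q ih =>
      exact .trans _ _ _ (.rel _ _ (hp _ _ (by simp)))
        (ih fun u v huv => hp u v (List.mem_cons_of_mem _ huv))
  induction h with
  | refl x => exact .refl x
  | symm x y _ ih => exact .symm _ _ ih
  | trans x y z _ _ ih₁ ih₂ => exact .trans _ _ _ ih₁ ih₂
  | rel x y hxy =>
    refine hwalk (g₂.path x y) fun u v huv => ?_
    have hadj : G.Adj u v := SimpleGraph.Walk.adj_of_mem_edges _ huv
    refine ⟨hadj.ne, ?_⟩
    have hlt := hxy.2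
    rw [SimplexOrdering.sorted_symm_lt_iff, PathChoice.ripsValue_edgeSimplex _ hW] at hlt ⊢
    rw [hσ]
    have hcost := hg₁ u v hadj
    have hpath : W s(u, v) < g₂.dist W x y ∨ s(u, v) = s(x, y) ∧ W s(u, v) = g₂.dist W x y :=
      weight_lt_or_eq_of_mem_edges hW _ huv
    rcases hpath with hW' | ⟨he, hW'⟩
    · left
      rcases hlt with h | ⟨h, -⟩ <;> linarith
    · have hedge : edgeSimplex u v = edgeSimplex x y := by
        rcases Sym2.eq_iff.1 he with ⟨rfl, rfl⟩ | ⟨rfl, rfl⟩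
        · rfl
        · exact edgeSimplex_comm _ _
      rw [hedge]
      rcases hlt with h | ⟨h, hπ⟩
      · left; linarith
      · rcases (hcost.trans (hW'.trans h).le).lt_or_eq with h' | h'
        · exact Or.inl h'
        · exact Or.inr ⟨h', hπ⟩

/-- A birth edge for the smaller distance has the same filtration value for both distances. -/
lemma ripsValue_eq_of_mem_bcdOne {g₁ g₂ : PathChoice G} (hg₁ : g₁.CostDominated W)
    (hd : ∀ v w : V, g₂.dist W v w ≤ g₁.dist W v w) (π : SimplexOrdering V) {σ τ : Simplex V}
    (h : (σ, τ) ∈ bcdOne (g₂.dist W) π) :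
    ripsValue (g₁.dist W) σ = ripsValue (g₂.dist W) σ := by
  obtain ⟨a, b, hadj, hW', rfl⟩ := exists_adj_of_mem_bcdOne hW g₂ π h
  rw [g₁.ripsValue_edgeSimplex hW, g₂.ripsValue_edgeSimplex hW]
  exact le_antisymm (hW' ▸ hg₁ a b hadj) (hd a b)

omit hW in
/-- Death times decrease: a chain whose boundary has `σ` as its last simplex in the first filtration
also does so in the second one, where it appears earlier. -/
lemma ripsValue_death_le {d₁ d₂ : V → V → ℝ} (hd : ∀ v w, d₂ v w ≤ d₁ v w)
    (π : SimplexOrdering V) {σ τ₁ τ₂ : Simplex V} (hσ : ripsValue d₁ σ = ripsValue d₂ σ)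
    (h₁ : IsPersistencePair (ripsValue d₁) π σ τ₁) (h₂ : IsPersistencePair (ripsValue d₂) π σ τ₂) :
    ripsValue d₂ τ₂ ≤ ripsValue d₁ τ₁ := by
  obtain ⟨v, hv, hlead⟩ := exists_isLeading_of_low_eq _ h₁
  have hlead' : IsLeading (π.sorted (ripsValue d₂)) v σ :=
    ⟨hlead.1, fun ρ hρ => hlead.2 ρ (π.sorted_symm_lt_of_le (ripsValue_mono hd ρ) hσ hρ)⟩
  obtain ⟨ρ, hρ, hle⟩ := exists_le_of_isLeading _ h₂ hv hlead'
  exact (π.le_of_sorted_symm_le _ hle).trans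
    ((ripsValue_mono hd ρ).trans (π.le_of_sorted_symm_le _ hρ))

/-- A birth edge for the smaller distance is also paired for the larger one. -/
lemma exists_isPersistencePair_of_mem_bcdOne {g₁ g₂ : PathChoice G} (hg₁ : g₁.CostDominated W)
    (hd : ∀ v w : V, g₂.dist W v w ≤ g₁.dist W v w) (π : SimplexOrdering V) {σ τ : Simplex V}
    (h : (σ, τ) ∈ bcdOne (g₂.dist W) π) :
    ∃ τ₁, IsPersistencePair (ripsValue (g₁.dist W)) π σ τ₁ := by
  have hσ := ripsValue_eq_of_mem_bcdOne hW hg₁ hd π h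
  obtain ⟨a, b, hab, rfl⟩ := exists_eq_edgeSimplex h.1
  obtain ⟨v, hv, hlead⟩ := exists_isLeading_of_low_eq _ h.2.1
  have hconn₂ := eqvGen_of_isLeading _ hab
    (Submodule.span_mono (Set.image_subset_range _ _) hv) hlead
  have hconn₁ := eqvGen_edgeBefore_of_costDominated hW hg₁ π hσ hconn₂
  obtain ⟨w, hw, hlead'⟩ := exists_isLeading_of_eqvGen _ hab hconn₁
  exact exists_low_eq_of_isLeading _ hw hlead'

end Birth

theorem mainTheorem2 {V : Type*} [Fintype V] [DecidableEq V] (G : SimpleGraph V)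
    (hG : G.Connected) (W : Sym2 V → ℝ) (hW : ∀ e ∈ G.edgeSet, 0 < W e)
    (g₁ g₂ : PathChoice G) (hg₁ : g₁.CostDominated W) (hg₂ : g₂.CostDominated W)
    (hd : ∀ v w : V, g₂.dist W v w ≤ g₁.dist W v w) :
    ∃ π : SimplexOrdering V,
      birthEdges (g₂.dist W) π ⊆ birthEdges (g₁.dist W) π ∧
      ∀ σ τ₂ τ₁ : Simplex V,
        (σ, τ₂) ∈ bcdOne (g₂.dist W) π → (σ, τ₁) ∈ bcdOne (g₁.dist W) π →
          ripsValue (g₂.dist W) τ₂ ≤ ripsValue (g₁.dist W) τ₁ := by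
  obtain ⟨π⟩ := SimplexOrdering.exists_simplexOrdering V
  refine ⟨π, ?_, fun σ τ₂ τ₁ h₂ h₁ => ?_⟩
  · rintro σ ⟨τ₂, h₂⟩
    have hσ := ripsValue_eq_of_mem_bcdOne hW hg₁ hd π h₂
    obtain ⟨τ₁, h₁⟩ := exists_isPersistencePair_of_mem_bcdOne hW hg₁ hd π h₂
    -- The bar is nonempty for the larger distance because it dies no earlier there.
    exact ⟨τ₁, h₂.1, h₁, (hσ.trans_lt h₂.2.2).trans_le (ripsValue_death_le hd π hσ h₁ h₂.2.1)⟩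
  · exact ripsValue_death_le hd π (ripsValue_eq_of_mem_bcdOne hW hg₁ hd π h₂) h₁.2.1 h₂.2.1
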